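/- A sequence of decay functions is a sequence $\mathcal{D}=(D_1,D_2,\dots)$ of functions $[0,\infty)\to[0,\infty)$ such that $D_1(x)\le x$ for all $x$, the sequence $(D_j(x))_{j\ge1}$ is non-increasing for each $x$, and each $D_j$ is non-decreasing; put $D_0(x)=x$. An instance $I=(F_1,\dots,F_n)$, of any size $n$, consists of probability distributions on $[0,\infty)$ with finite expectation; let $X_i\sim F_i$ be independent. An online algorithm knows $\mathcal{D}$ and $I$, observes $X_{\pi(1)},X_{\pi(2)},\dots,X_{\pi(n)}$ one after the other, and stops at a stopping time $\tau\in\{1,\dots,n+1\}$, possibly using a random seed that is independent of the values and of the order ($\tau=n+1$ means that it never stops). In the adversarial order model, $\pi$ is the identity; in the random order model, $\pi$ is a uniformly random permutation independent of the values, and the algorithm may or may not be shown, together with each value, the index $\pi(i)$ of the item (the result holds in both versions). If the algorithm $\mathsf{A}$ stops at $\tau$, its reward in the $\mathcal{D}$-prophet inequality is \[ \mathsf{A}^{\mathcal{D}}(I)=\max_{1\le i\le \min(\tau,n)} D_{\tau-i}(X_{\pi(i)}), \] and its competitive ratio is \[ \mathsf{CR}^{\mathcal{D}}(\mathsf{A})=\inf_{I}\frac{\mathbb{E}[\mathsf{A}^{\mathcal{D}}(I)]}{\mathbb{E}[\max_{i}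 X_i]}, \] the infimum being over all instances $I$ with $\mathbb{E}[\max_i X_i]>0$. An algorithm is optimal for the $\mathcal{D}$-prophet inequality if its competitive ratio $\mathsf{CR}^{\mathcal{D}}$ is maximal among all algorithms. Let $D_\infty(x)=\lim_{j\to\infty}D_j(x)$ be the pointwise limit of a sequence $\mathcal{D}$ of decay functions, and call $D_\infty$-prophet inequality the problem in which all decay functions are equal to $D_\infty$. **Corollary.** In the adversarial order model and in the random order model, if an algorithm $\overline{\mathsf{A}}_\infty$ is optimal for the $D_\infty$-prophet inequality, then it is also optimal for the $\mathcal{D}$-prophet inequality, and \[ \mathsf{CR}^{\mathcal{D}}(\overline{\mathsf{A}}_\infty)=\mathsf{CR}^{D_\infty}(\overline{\mathsf{A}}_\infty). \] -/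

import Mathlib

open Filter Topology MeasureTheory
open scoped NNReal ENNReal

namespace Prophet

/-- `D 1, D 2, …` is a sequence of decay functions on `[0, ∞)`. The entry `D 0` plays no role. -/
structure IsDecay (D : ℕ → ℝ≥0 → ℝ≥0) : Prop where
  one_le : ∀ x, D 1 x ≤ x
  anti : ∀ x i j, 1 ≤ i → i ≤ j → D j x ≤ D i x
  mono : ∀ j, 1 ≤ j → Monotone (D j)

/-- The value recovered from an item of value `x` that was observed `j` steps ago: it is `x` for
`j = 0` (the current item) and `D j x` for `j ≥ 1`. -/
def recover (D : ℕ → ℝ≥0 → ℝ≥0) (j : ℕ) (x : ℝ≥0) : ℝ≥0 :=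
  if j = 0 then x else D j x

/-- The reward for stopping at step `t` when the values `y 0, …, y (n - 1)` are observed in this
order, `y k` at step `k + 1`: the maximum over the steps `s ≤ t` (and `s ≤ n`) of the value
recovered from the item of step `s`. Stopping at `t = n + 1` means that the algorithm has not
stopped at any of the steps `1, …, n`. -/
def reward (D : ℕ → ℝ≥0 → ℝ≥0) {n : ℕ} (t : ℕ) (y : Fin n → ℝ≥0) : ℝ≥0 :=
  (Finset.univ.filter fun k : Fin n => k.val + 1 ≤ t).sup fun k => recover D (t - (k.val + 1)) (y k)

/-- An input: a tuple of any size of probability distributions on `[0, ∞)` with finite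
expectation. -/
structure Input where
  n : ℕ
  F : Fin n → ProbabilityMeasure ℝ≥0
  finite_mean : ∀ i, ∫⁻ x, (x : ℝ≥0∞) ∂(F i : Measure ℝ≥0) ≠ ∞

/-- The joint law of independent `X i ∼ F i`. -/
noncomputable def Input.law (I : Input) : Measure (Fin I.n → ℝ≥0) :=
  Measure.pi fun i => (I.F i : Measure ℝ≥0)

/-- The expected maximum `𝔼[OPT(I)]`. -/
noncomputable def Input.opt (I : Input) : ℝ≥0∞ :=
  ∫⁻ x, ((Finset.univ.sup x : ℝ≥0) : ℝ≥0∞) ∂I.law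

/-- The order models: the fixed order `X 0, X 1, …` of the input, or a uniformly random order. In
the random order, the algorithm sees only the values (`randomOrder`), or it also sees, with each
value, the index of the distribution from which it was drawn (`randomOrderLabelled`). -/
inductive OrderModel where
  | adversarial
  | randomOrder
  | randomOrderLabelled

/-- The law of the observation order `σ`: the item observed at step `k + 1` is the item `σ k`. -/
noncomputable def OrderModel.orderLaw : OrderModel → (n : ℕ) → PMF (Equiv.Perm (Fin n))
  | adversarial, _ => PMF.pure 1
  | randomOrder, _ => PMF.uniformOfFintype _
  | randomOrderLabelled, _ => PMF.uniformOfFintype _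

/-- What the algorithm learns, besides its value, about the item `i` when it observes it. -/
def OrderModel.label {n : ℕ} : OrderModel → Fin n → Option (Fin n)
  | adversarial, _ => none
  | randomOrder, _ => none
  | randomOrderLabelled, i => some i

/-- An online algorithm with internal randomness `ω : Ω` (drawn once, before the first
observation). It knows the input `I`, i.e. the number of items and their distributions, and `stopTime`
is its stopping time, as a function of the seed `ω`, of the labels `ℓ k` and of the values `y k`
observed at the steps `k + 1`. The stopping time is measurable, and whether it is equal to `t` is
determined by what is observed in the first `t` steps. Deterministic algorithms are those with a
one-point `Ω`. -/
structure Algorithm (Ω : Type*) [MeasurableSpace Ω] where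
  stopTime : (I : Input) → Ω → (Fin I.n → Option (Fin I.n)) → (Fin I.n → ℝ≥0) → ℕ
  one_le_stopTime : ∀ I ω ℓ y, 1 ≤ stopTime I ω ℓ y
  stopTime_le : ∀ I ω ℓ y, stopTime I ω ℓ y ≤ I.n + 1
  measurable_stopTime : ∀ I ℓ, Measurable fun p : Ω × (Fin I.n → ℝ≥0) => stopTime I p.1 ℓ p.2
  nonanticipating : ∀ I ω ℓ ℓ' y y',
    (∀ k : Fin I.n, k.val + 1 ≤ stopTime I ω ℓ y → ℓ k = ℓ' k ∧ y k = y' k) →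
      stopTime I ω ℓ' y' = stopTime I ω ℓ y

variable {Ω : Type*} [MeasurableSpace Ω]

/-- The expected reward `𝔼[A^D(I)]` with decay functions `D` in the order model `M`; the observation
order `σ`, the seed `ω ∼ P` and the values `x i ∼ F i` are independent. -/
noncomputable def Algorithm.expReward (A : Algorithm Ω) (P : Measure Ω) (M : OrderModel)
    (D : ℕ → ℝ≥0 → ℝ≥0) (I : Input) : ℝ≥0∞ :=
  ∑ σ : Equiv.Perm (Fin I.n), M.orderLaw I.n σ *
    ∫⁻ p, (reward D (A.stopTime I p.1 (fun k => M.label (σ k)) fun k => p.2 (σ k))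
      (fun k => p.2 (σ k)) : ℝ≥0∞) ∂(P.prod I.law)

/-- The competitive ratio `CR^D(A)`: the infimum of `𝔼[A^D(I)] / 𝔼[OPT(I)]` over all inputs, those
with `𝔼[OPT(I)] = 0`, where the ratio is `0 / 0`, being left out. -/
noncomputable def Algorithm.competitiveRatio (A : Algorithm Ω) (P : Measure Ω) (M : OrderModel)
    (D : ℕ → ℝ≥0 → ℝ≥0) : ℝ≥0∞ :=
  ⨅ (I : Input) (_ : I.opt ≠ 0), A.expReward P M D I / I.opt

/-- `A` is optimal for the `D`-prophet inequality: its competitive ratio is maximal. -/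
def Algorithm.IsOptimal (A : Algorithm Ω) (P : Measure Ω) (M : OrderModel)
    (D : ℕ → ℝ≥0 → ℝ≥0) : Prop :=
  ∀ B : Algorithm Ω, B.competitiveRatio P M D ≤ A.competitiveRatio P M D

end Prophet

namespace Prophet

/-! Since `Dinf ≤ D j` for `j ≥ 1`, every algorithm earns at least as much with `D` as with `Dinf`.
Conversely, pad an input `I` with items of value `0` so that its own items are observed at least `m`
steps apart. The expected maximum does not change, while every item but the last one seen is
recovered through at most `D m`; the expected excess over `Dinf` tends to `0` as `m → ∞`, by
dominated convergence. So an algorithm `B` for `D` yields an algorithm `C` for `Dinf`: on `I`, it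
runs `B` on the padded input and inserts the zeros itself. It loses at most `δ` in the ratio
(`exists_competitiveRatio_le`), whence `CR^D(B) ≤ CR^Dinf(C) + δ ≤ CR^Dinf(A) + δ` for every `A`
optimal for `Dinf`.

In the adversarial order the gaps are built into the padding. In the random orders there are so many
zeros that two items are rarely close (`card_closeOrders_le`). Given the positions of the items and
the arrangement of the zeros, the relative order of the items is still uniform. A best such pattern
does at least as well as the average one, so `C` can fix it in advance and needs no randomness
beyond the seed of `B`. -/

theorem IsDecay.le_self {D : ℕ → ℝ≥0 → ℝ≥0} (hD : IsDecay D) {j : ℕ} (hj : 1 ≤ j) (x : ℝ≥0) :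
    D j x ≤ x :=
  (hD.anti x 1 j le_rfl hj).trans (hD.one_le x)

theorem IsDecay.recover_le_self {D : ℕ → ℝ≥0 → ℝ≥0} (hD : IsDecay D) (j : ℕ) (x : ℝ≥0) :
    recover D j x ≤ x := by
  unfold recover
  split_ifs with h
  · exact le_rfl
  · exact hD.le_self (Nat.one_le_iff_ne_zero.2 h) x

theorem IsDecay.reward_le_sup {D : ℕ → ℝ≥0 → ℝ≥0} (hD : IsDecay D) {n : ℕ} (t : ℕ)
    (y : Fin n → ℝ≥0) : reward D t y ≤ Finset.univ.sup y :=
  Finset.sup_le fun k _ => (hD.recover_le_self _ _).trans (Finset.le_sup (Finset.mem_univ k))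

/-! ### Comparison with the limit, and items spread out among zeros -/

section Limit

variable {D : ℕ → ℝ≥0 → ℝ≥0} {Dinf : ℝ≥0 → ℝ≥0}

theorem IsDecay.limit_le (hD : IsDecay D) (hDinf : ∀ x, Tendsto (fun j => D j x) atTop (𝓝 (Dinf x)))
    {j : ℕ} (hj : 1 ≤ j) (x : ℝ≥0) : Dinf x ≤ D j x :=
  le_of_tendsto (hDinf x) (eventually_atTop.2 ⟨j, fun i hi => hD.anti x j i hj hi⟩)

theorem IsDecay.limit_mono (hD : IsDecay D)
    (hDinf : ∀ x, Tendsto (fun j => D j x) atTop (𝓝 (Dinf x))) : Monotone Dinf := fun x y hxy =>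
  le_of_tendsto_of_tendsto (hDinf x) (hDinf y)
    (eventually_atTop.2 ⟨1, fun j hj => hD.mono j hj hxy⟩)

theorem IsDecay.reward_limit_le (hD : IsDecay D)
    (hDinf : ∀ x, Tendsto (fun j => D j x) atTop (𝓝 (Dinf x))) {n : ℕ} (t : ℕ)
    (y : Fin n → ℝ≥0) : reward (fun _ => Dinf) t y ≤ reward D t y := by
  refine Finset.sup_mono_fun fun k _ => ?_
  unfold recover
  split_ifs with h
  · exact le_rfl
  · exact hD.limit_le hDinf (Nat.one_le_iff_ne_zero.2 h) _

/-- The total loss when the values recovered after `m` steps are replaced by their limits. -/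
noncomputable def decayLoss (D : ℕ → ℝ≥0 → ℝ≥0) (Dinf : ℝ≥0 → ℝ≥0) (m : ℕ) {n : ℕ}
    (y : Fin n → ℝ≥0) : ℝ≥0 :=
  ∑ j, (D m (y j) - Dinf (y j))

/-- The step of an item sequence at which to stop if the items sit at the positions `e` of a longer
sequence that is stopped at `T`: the step of the last item seen, or `1` if none was seen. -/
def lastSeen {n N : ℕ} (e : Fin n → Fin N) (T : ℕ) : ℕ :=
  max 1 ((Finset.univ.filter fun j : Fin n => (e j).val + 1 ≤ T).sup fun j => j.val + 1)

theorem le_lastSeen {n N : ℕ} {e : Fin n → Fin N} {T : ℕ} {j : Fin n} (h : (e j).val + 1 ≤ T) :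
    j.val + 1 ≤ lastSeen e T :=
  le_max_of_le_right (Finset.le_sup (f := fun j : Fin n => j.val + 1)
    (Finset.mem_filter.2 ⟨Finset.mem_univ j, h⟩))

theorem exists_eq_lastSeen {n N : ℕ} {e : Fin n → Fin N} {T : ℕ} {i : Fin n}
    (hi : (e i).val + 1 ≤ T) : ∃ j : Fin n, (e j).val + 1 ≤ T ∧ j.val + 1 = lastSeen e T := by
  obtain ⟨j, hj, h⟩ := Finset.exists_mem_eq_sup
    (Finset.univ.filter fun j : Fin n => (e j).val + 1 ≤ T)
    ⟨i, Finset.mem_filter.2 ⟨Finset.mem_univ i, hi⟩⟩ fun j : Fin n => j.val + 1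
  refine ⟨j, (Finset.mem_filter.1 hj).2, ?_⟩
  unfold lastSeen
  rw [h]
  exact (max_eq_right (Nat.le_add_left 1 _)).symm

/-- If the items `y` sit in a sequence of zeros at distances at least `m`, then stopping at the last
item seen loses at most `decayLoss D Dinf m y` in comparison. -/
theorem IsDecay.reward_extend_le (hD : IsDecay D) {m n N : ℕ} (hm : 1 ≤ m) {e : Fin n → Fin N}
    (he : ∀ i j, i < j → (e i).val + m ≤ (e j).val) (T : ℕ) (y : Fin n → ℝ≥0) :
    reward D T (Function.extend e y 0) ≤
      reward (fun _ => Dinf) (lastSeen e T) y + decayLoss D Dinf m y := by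
  have hinj : Function.Injective e := StrictMono.injective fun i j hij => by
    have := he i j hij
    exact Fin.lt_def.2 (by omega)
  refine Finset.sup_le fun k hk => ?_
  have hkT := (Finset.mem_filter.1 hk).2
  by_cases hke : ∃ j, e j = k
  · obtain ⟨i, rfl⟩ := hke
    rw [hinj.extend_apply]
    obtain ⟨j, hjT, hj⟩ := exists_eq_lastSeen hkT
    have hi := le_lastSeen hkT
    have hrew : recover (fun _ => Dinf) (lastSeen e T - (i.val + 1)) (y i) ≤
        reward (fun _ => Dinf) (lastSeen e T) y :=
      Finset.le_sup (f := fun i : Fin n =>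
        recover (fun _ => Dinf) (lastSeen e T - (i.val + 1)) (y i))
        (Finset.mem_filter.2 ⟨Finset.mem_univ i, hi⟩)
    -- Either item `i` is the last one seen, and stopping there recovers it in full, or a later
    -- item, at least `m` positions further on, was also shown by time `T`.
    rcases hi.eq_or_lt with heq | hlt
    · refine le_add_right (le_trans (hD.recover_le_self _ _) (le_trans ?_ hrew))
      simp [recover, heq]
    · have hgap := he i j (Fin.lt_def.2 (by omega))
      have hstep : m ≤ T - ((e i).val + 1) := by omega
      have h1 : recover D (T - ((e i).val + 1)) (y i) ≤ D m (y i) := by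
        rw [recover, if_neg (by omega)]
        exact hD.anti _ _ _ hm hstep
      have h2 : recover (fun _ => Dinf) (lastSeen e T - (i.val + 1)) (y i) = Dinf (y i) := by
        rw [recover, if_neg (by omega)]
      have h3 : D m (y i) - Dinf (y i) ≤ decayLoss D Dinf m y :=
        Finset.single_le_sum (f := fun j => D m (y j) - Dinf (y j)) (fun _ _ => zero_le)
          (Finset.mem_univ i)
      calc recover D (T - ((e i).val + 1)) (y i) ≤ D m (y i) := h1
        _ ≤ Dinf (y i) + (D m (y i) - Dinf (y i)) := le_add_tsub
        _ ≤ _ := add_le_add (h2 ▸ hrew) h3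
  · rw [Function.extend_apply' _ _ _ hke]
    exact (hD.recover_le_self _ _).trans zero_le

end Limit

/-! ### Inputs padded with zeros, and the vanishing expected loss -/

section Padding

theorem measurable_extend {α : Type*} [MeasurableSpace α] {n N : ℕ} (e : Fin n → Fin N)
    (z : Fin N → α) : Measurable fun y : Fin n → α => Function.extend e y z := by
  refine measurable_pi_lambda _ fun k => ?_
  unfold Function.extend
  split_ifs
  · exact measurable_pi_apply _
  · exact measurable_const

theorem measurable_sup_univ (n : ℕ) : Measurable fun x : Fin n → ℝ≥0 => Finset.univ.sup x := by
  have h : (fun x : Fin n → ℝ≥0 => Finset.univ.sup x) =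
      Finset.univ.sup fun i => fun x : Fin n → ℝ≥0 => x i := by
    ext x
    rw [Finset.sup_apply]
  rw [h]
  exact Finset.sup_induction (p := Measurable) measurable_const (fun _ h₁ _ h₂ => h₁.sup h₂)
    fun i _ => measurable_pi_apply i

/-- The distribution of an item of value `0`. -/
noncomputable def zeroLaw : ProbabilityMeasure ℝ≥0 :=
  ⟨Measure.dirac 0, Measure.dirac.isProbabilityMeasure⟩

theorem coe_zeroLaw : (zeroLaw : Measure ℝ≥0) = Measure.dirac 0 :=
  rfl

/-- The input `I` padded with items of value `0`; the item `j` of `I` becomes the item `f j`. -/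
noncomputable abbrev Input.pad (I : Input) {N : ℕ} (f : Fin I.n → Fin N) : Input where
  n := N
  F := Function.extend f I.F fun _ => zeroLaw
  finite_mean k := by
    by_cases hk : ∃ j, f j = k
    · unfold Function.extend
      rw [dif_pos hk]
      exact I.finite_mean _
    · simp [Function.extend_apply' _ _ _ hk, coe_zeroLaw]

instance (I : Input) : IsProbabilityMeasure I.law := by
  unfold Input.law
  infer_instance

theorem Input.law_pad (I : Input) {N : ℕ} {f : Fin I.n → Fin N} (hf : Function.Injective f) :
    (I.pad f).law = I.law.map fun x => Function.extend f x 0 := by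
  refine Measure.pi_eq fun s hs => ?_
  rw [Measure.map_apply (measurable_extend f 0) (MeasurableSet.univ_pi hs)]
  have hpre : (fun x : Fin I.n → ℝ≥0 => Function.extend f x 0) ⁻¹' Set.univ.pi s =
      {x | ∀ j, x j ∈ s (f j)} ∩ {_x | ∀ k, k ∉ Set.range f → (0 : ℝ≥0) ∈ s k} := by
    ext x
    simp only [Set.mem_preimage, Set.mem_univ_pi, Set.mem_inter_iff, Set.mem_ofPred_eq]
    constructor
    · intro h
      refine ⟨fun j => by simpa [hf.extend_apply] using h (f j), fun k hk => ?_⟩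
      simpa [Function.extend_apply' _ _ _ hk] using h k
    · rintro ⟨h1, h2⟩ k
      by_cases hk : k ∈ Set.range f
      · obtain ⟨j, rfl⟩ := hk
        simpa [hf.extend_apply] using h1 j
      · simpa [Function.extend_apply' _ _ _ hk] using h2 k hk
  have hpi : I.law {x | ∀ j, x j ∈ s (f j)} = ∏ j, (I.F j : Measure ℝ≥0) (s (f j)) := by
    rw [← Measure.pi_pi]
    congr 1
    ext x
    simp
  have hprod : ∏ k, ((I.pad f).F k : Measure ℝ≥0) (s k) =
      (∏ j, (I.F j : Measure ℝ≥0) (s (f j))) *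
        ∏ k ∈ (Finset.univ.image f)ᶜ, (Measure.dirac (0 : ℝ≥0)) (s k) := by
    rw [← Finset.prod_mul_prod_compl (Finset.univ.image f), Finset.prod_image hf.injOn]
    congr 1
    · refine Finset.prod_congr rfl fun j _ => ?_
      simp only [hf.extend_apply]
    · refine Finset.prod_congr rfl fun k hk => ?_
      have hk' : ¬∃ j, f j = k := by simpa using hk
      simp only [Function.extend_apply' _ _ _ hk', coe_zeroLaw]
  refine Eq.trans ?_ hprod.symm
  rw [hpre]
  by_cases h0 : ∀ k, k ∉ Set.range f → (0 : ℝ≥0) ∈ s k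
  · have h1 : ∏ k ∈ (Finset.univ.image f)ᶜ, (Measure.dirac (0 : ℝ≥0)) (s k) = 1 := by
      refine Finset.prod_eq_one fun k hk => ?_
      exact Measure.dirac_apply_of_mem (h0 k (by simpa using hk))
    rw [h1, mul_one, ← hpi]
    congr 1
    ext x
    simp only [Set.mem_inter_iff, Set.mem_ofPred_eq]
    exact and_iff_left h0
  -- A filler coordinate whose set misses `0` makes both sides vanish.
  · push Not at h0
    obtain ⟨k, hk, hk0⟩ := h0
    rw [Finset.prod_eq_zero (i := k) (by simpa using hk)
      (by simp [Measure.dirac_apply' _ (hs k), hk0]), mul_zero]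
    convert measure_empty (μ := I.law)
    ext x
    simp only [Set.mem_inter_iff, Set.mem_ofPred_eq, Set.mem_empty_iff_false, iff_false, not_and]
    exact fun _ h => hk0 (h k hk)

theorem sup_extend_zero {n N : ℕ} {f : Fin n → Fin N} (hf : Function.Injective f)
    (x : Fin n → ℝ≥0) : Finset.univ.sup (Function.extend f x 0) = Finset.univ.sup x := by
  apply le_antisymm
  · refine Finset.sup_le fun k _ => ?_
    by_cases hk : ∃ j, f j = k
    · obtain ⟨j, rfl⟩ := hk
      rw [hf.extend_apply]
      exact Finset.le_sup (Finset.mem_univ j)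
    · rw [Function.extend_apply' _ _ _ hk]
      exact zero_le
  · refine Finset.sup_le fun j _ => ?_
    rw [← hf.extend_apply x 0 j]
    exact Finset.le_sup (Finset.mem_univ (f j))

theorem Input.opt_pad (I : Input) {N : ℕ} {f : Fin I.n → Fin N} (hf : Function.Injective f) :
    (I.pad f).opt = I.opt := by
  unfold Input.opt
  rw [I.law_pad hf, lintegral_map (measurable_sup_univ N).coe_nnreal_ennreal (measurable_extend f 0)]
  simp only [sup_extend_zero hf]

theorem Input.lintegral_eval (I : Input) (i : Fin I.n) {g : ℝ≥0 → ℝ≥0∞} (hg : Measurable g) :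
    ∫⁻ x, g (x i) ∂I.law = ∫⁻ x, g x ∂(I.F i : Measure ℝ≥0) :=
  (measurePreserving_eval (fun i => (I.F i : Measure ℝ≥0)) i).lintegral_comp hg

theorem Input.lintegral_sum_ne_top (I : Input) :
    ∫⁻ x : Fin I.n → ℝ≥0, ∑ i, (x i : ℝ≥0∞) ∂I.law ≠ ∞ := by
  rw [lintegral_finsetSum _ fun i _ => (measurable_pi_apply i).coe_nnreal_ennreal]
  refine ENNReal.sum_ne_top.2 fun i _ => ?_
  rw [I.lintegral_eval i measurable_coe_nnreal_ennreal]
  exact I.finite_mean i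

theorem Input.opt_ne_top (I : Input) : I.opt ≠ ∞ := by
  refine ne_top_of_le_ne_top I.lintegral_sum_ne_top (lintegral_mono fun x => ?_)
  rw [← ENNReal.ofNNReal_finsetSum, ENNReal.coe_le_coe]
  exact Finset.sup_le fun i _ => Finset.single_le_sum (fun _ _ => zero_le) (Finset.mem_univ i)

variable {D : ℕ → ℝ≥0 → ℝ≥0} {Dinf : ℝ≥0 → ℝ≥0}

/-- Monotonicity of the decay functions serves in the proof only as the source of this
measurability. -/
theorem IsDecay.measurable_decayLoss (hD : IsDecay D)
    (hDinf : ∀ x, Tendsto (fun j => D j x) atTop (𝓝 (Dinf x))) {m : ℕ} (hm : 1 ≤ m) (n : ℕ) :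
    Measurable fun y : Fin n → ℝ≥0 => decayLoss D Dinf m y := by
  unfold decayLoss
  exact Finset.measurable_sum _ fun i _ =>
    ((hD.mono m hm).measurable.comp (measurable_pi_apply i)).sub
      ((hD.limit_mono hDinf).measurable.comp (measurable_pi_apply i))

theorem IsDecay.tendsto_lintegral_decayLoss (hD : IsDecay D)
    (hDinf : ∀ x, Tendsto (fun j => D j x) atTop (𝓝 (Dinf x))) (I : Input) :
    Tendsto (fun m => ∫⁻ x : Fin I.n → ℝ≥0, (decayLoss D Dinf m x : ℝ≥0∞) ∂I.law) atTop (𝓝 0) := by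
  -- `D 0` is arbitrary, so the domination by the sum of the values, integrable by the finite means,
  -- is available only from `m = 1` on.
  rw [← tendsto_add_atTop_iff_nat 1]
  rw [← lintegral_zero (μ := I.law)]
  refine tendsto_lintegral_of_dominated_convergence
    (fun x : Fin I.n → ℝ≥0 => ∑ i, (x i : ℝ≥0∞)) (fun m => ?_) (fun m => ?_)
    I.lintegral_sum_ne_top ?_
  · exact (hD.measurable_decayLoss hDinf (Nat.le_add_left 1 m) I.n).coe_nnreal_ennreal
  · refine Eventually.of_forall fun x => ?_
    unfold decayLoss
    push_cast
    exact Finset.sum_le_sum fun i _ => tsub_le_self.trans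
      (ENNReal.coe_le_coe.2 (hD.le_self (Nat.le_add_left 1 m) _))
  · refine Eventually.of_forall fun x => ?_
    have h : Tendsto (fun m => decayLoss D Dinf m x) atTop (𝓝 0) := by
      have := tendsto_finsetSum (Finset.univ : Finset (Fin I.n)) fun i _ =>
        (hDinf (x i)).sub (tendsto_const_nhds (x := Dinf (x i)))
      simpa [decayLoss] using this
    exact ENNReal.tendsto_coe.2 ((tendsto_add_atTop_iff_nat 1).2 h)

end Padding

/-! ### Simulating an algorithm on a longer input -/

/-- A way to feed the items of `I`, as they are observed, to an algorithm that runs on the longer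
input `J`: the item observed at step `k + 1` is shown to it at the position `pos k`, the label `i`
is translated to `item i`, and at the other positions it is shown the value `0` with the label given
by `filler`. -/
structure Simulation (I : Input) where
  J : Input
  pos : Fin I.n → Fin J.n
  item : Fin I.n → Fin J.n
  filler : Fin J.n → Option (Fin J.n)

section Simulate

variable {Ω : Type*} [MeasurableSpace Ω] {D : ℕ → ℝ≥0 → ℝ≥0} {Dinf : ℝ≥0 → ℝ≥0}

/-- The time at which the simulated algorithm `A` leads to a stop. -/
noncomputable def Simulation.stopTime {I : Input} (s : Simulation I) (A : Algorithm Ω) (ω : Ω)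
    (ℓ : Fin I.n → Option (Fin I.n)) (y : Fin I.n → ℝ≥0) : ℕ :=
  lastSeen s.pos (A.stopTime s.J ω
    (Function.extend s.pos (fun j => (ℓ j).map s.item) s.filler) (Function.extend s.pos y 0))

theorem extend_congr {α : Type*} {n N : ℕ} {e : Fin n → Fin N} {y y' : Fin n → α} {z : Fin N → α}
    {k : Fin N} (h : ∀ j, e j = k → y j = y' j) :
    Function.extend e y z k = Function.extend e y' z k := by
  unfold Function.extend
  split_ifs with hk
  · exact h _ (Classical.choose_spec hk)
  · rfl

/-- The algorithm that, on the input `I`, simulates `A` according to `S I`. -/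
noncomputable def Algorithm.simulate (A : Algorithm Ω) (S : ∀ I, Simulation I) : Algorithm Ω where
  stopTime I ω ℓ y := (S I).stopTime A ω ℓ y
  one_le_stopTime _ _ _ _ := le_max_left _ _
  stopTime_le I _ _ _ := max_le (Nat.le_add_left 1 _) (Finset.sup_le fun j _ => by omega)
  measurable_stopTime I ℓ :=
    (measurable_from_top (f := lastSeen (S I).pos)).comp
      ((A.measurable_stopTime (S I).J _).comp
        (measurable_fst.prodMk ((measurable_extend _ _).comp measurable_snd)))
  nonanticipating I ω ℓ ℓ' y y' h := by
    unfold Simulation.stopTime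
    congr 1
    -- Every item placed by the time `A` stops has been seen by `lastSeen`, so the two padded
    -- sequences agree up to that time.
    refine A.nonanticipating _ _ _ _ _ _ fun k hk => ⟨extend_congr ?_, extend_congr ?_⟩
    · rintro j rfl
      rw [(h j (le_lastSeen hk)).1]
    · rintro j rfl
      exact (h j (le_lastSeen hk)).2

/-- The expected reward of the simulated algorithm when the observation order is `σ`. -/
noncomputable def Simulation.orderReward {I : Input} (s : Simulation I) (A : Algorithm Ω)
    (P : Measure Ω) (M : OrderModel) (D : ℕ → ℝ≥0 → ℝ≥0) (σ : Equiv.Perm (Fin I.n)) : ℝ≥0∞ :=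
  ∫⁻ p, (reward D (s.stopTime A p.1 (fun k => M.label (σ k)) fun k => p.2 (σ k))
    (fun k => p.2 (σ k)) : ℝ≥0∞) ∂(P.prod I.law)

/-- The expected reward of `A` when the observation order is `σ`. -/
noncomputable def Algorithm.orderReward (A : Algorithm Ω)
    (P : Measure Ω) (M : OrderModel) (D : ℕ → ℝ≥0 → ℝ≥0) (I : Input)
    (σ : Equiv.Perm (Fin I.n)) : ℝ≥0∞ :=
  ∫⁻ p, (reward D (A.stopTime I p.1 (fun k => M.label (σ k)) fun k => p.2 (σ k))
    (fun k => p.2 (σ k)) : ℝ≥0∞) ∂(P.prod I.law)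

theorem Algorithm.expReward_eq_sum (A : Algorithm Ω) (P : Measure Ω) (M : OrderModel)
    (D : ℕ → ℝ≥0 → ℝ≥0) (I : Input) :
    A.expReward P M D I = ∑ σ, M.orderLaw I.n σ * A.orderReward P M D I σ :=
  rfl

variable {P : Measure Ω} [IsProbabilityMeasure P]

theorem IsDecay.orderReward_le_opt (hD : IsDecay D) (A : Algorithm Ω) (M : OrderModel) (I : Input)
    (σ : Equiv.Perm (Fin I.n)) : A.orderReward P M D I σ ≤ I.opt := by
  have h : ∫⁻ p : Ω × (Fin I.n → ℝ≥0), ((Finset.univ.sup p.2 : ℝ≥0) : ℝ≥0∞) ∂(P.prod I.law) =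
      I.opt :=
    measurePreserving_snd.lintegral_comp (measurable_sup_univ I.n).coe_nnreal_ennreal
  rw [← h]
  refine lintegral_mono fun p => ENNReal.coe_le_coe.2 ((hD.reward_le_sup _ _).trans ?_)
  exact Finset.sup_le fun k _ => Finset.le_sup (Finset.mem_univ (σ k))

theorem decayLoss_comp_perm {m n : ℕ} (a : Equiv.Perm (Fin n)) (x : Fin n → ℝ≥0) :
    decayLoss D Dinf m (fun k => x (a k)) = decayLoss D Dinf m x :=
  Equiv.sum_comp a fun j => D m (x j) - Dinf (x j)

theorem OrderModel.label_map (M : OrderModel) {n N : ℕ} (f : Fin n → Fin N) (i : Fin n) :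
    M.label (f i) = (M.label i).map f := by
  cases M <;> rfl

/-- By `ha` and `hc`, the padded input observed in order `σ` is, values and labels alike, the input
`I` observed in order `a` and spread over the positions `e`. The bound is then `reward_extend_le`
integrated. -/
theorem IsDecay.orderReward_pad_le (hD : IsDecay D)
    (hDinf : ∀ x, Tendsto (fun j => D j x) atTop (𝓝 (Dinf x))) (A : Algorithm Ω) (M : OrderModel)
    {I : Input} {m N : ℕ} (hm : 1 ≤ m) {e f : Fin I.n → Fin N} (hf : Function.Injective f)
    (he : ∀ i j, i < j → (e i).val + m ≤ (e j).val) {c : Fin N → Option (Fin N)}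
    {σ : Equiv.Perm (Fin N)} {a : Equiv.Perm (Fin I.n)} (ha : ∀ j, σ (e j) = f (a j))
    (hc : ∀ k, k ∉ Set.range e → c k = M.label (σ k)) :
    A.orderReward P M D (I.pad f) σ ≤
      Simulation.orderReward ⟨I.pad f, e, f, c⟩ A P M (fun _ => Dinf) a +
        ∫⁻ x : Fin I.n → ℝ≥0, (decayLoss D Dinf m x : ℝ≥0∞) ∂I.law := by
  have hinj : Function.Injective e := StrictMono.injective fun i j hij => by
    have := he i j hij
    exact Fin.lt_def.2 (by omega)
  have hvalues (x : Fin I.n → ℝ≥0) : (fun k => Function.extend f x 0 (σ k)) =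
      Function.extend e (fun k => x (a k)) 0 := by
    ext k
    by_cases hk : ∃ j, e j = k
    · obtain ⟨j, rfl⟩ := hk
      rw [ha, hf.extend_apply, hinj.extend_apply]
    · rw [Function.extend_apply' _ _ _ hk, Function.extend_apply']
      · rfl
      · rintro ⟨i, hi⟩
        refine hk ⟨a.symm i, σ.injective ?_⟩
        rw [ha, a.apply_symm_apply, hi]
  have hlabels : (fun k => M.label (σ k)) =
      Function.extend e (fun k => (M.label (a k)).map f) c := by
    funext k
    by_cases hk : ∃ j, e j = k
    · obtain ⟨j, rfl⟩ := hk
      rw [ha, hinj.extend_apply, M.label_map]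
    · rw [Function.extend_apply' _ _ _ hk]
      exact (hc k hk).symm
  have hloss : ∫⁻ p : Ω × (Fin I.n → ℝ≥0), (decayLoss D Dinf m p.2 : ℝ≥0∞) ∂(P.prod I.law) =
      ∫⁻ x : Fin I.n → ℝ≥0, (decayLoss D Dinf m x : ℝ≥0∞) ∂I.law :=
    measurePreserving_snd.lintegral_comp
      (hD.measurable_decayLoss hDinf hm I.n).coe_nnreal_ennreal
  have hmeas : Measurable fun p : Ω × (Fin I.n → ℝ≥0) => (decayLoss D Dinf m p.2 : ℝ≥0∞) :=
    ((hD.measurable_decayLoss hDinf hm I.n).comp measurable_snd).coe_nnreal_ennreal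
  have hprod : P.prod (I.pad f).law =
      (P.prod I.law).map (Prod.map id fun x => Function.extend f x 0) := by
    rw [I.law_pad hf, ← Measure.map_prod_map _ _ measurable_id (measurable_extend f 0),
      Measure.map_id]
  unfold Algorithm.orderReward Simulation.orderReward
  rw [hprod, ← hloss, ← lintegral_add_right _ hmeas]
  -- Only `≤` is needed, and this direction holds without measurability of the reward.
  refine (lintegral_map_le _ _).trans (lintegral_mono fun p => ?_)
  rw [← ENNReal.coe_add, ENNReal.coe_le_coe]
  simp only [Prod.map_fst, Prod.map_snd, id]
  rw [← decayLoss_comp_perm a p.2, hvalues, hlabels]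
  exact hD.reward_extend_le hm he _ _

end Simulate

/-! ### Counting the orders in which two items are close -/

section Orders

theorem exists_perm_strictMono_comp {n N : ℕ} {g : Fin n → Fin N} (hg : Function.Injective g) :
    ∃ a : Equiv.Perm (Fin n), StrictMono fun j => g (a j) :=
  ⟨Tuple.sort g, (Tuple.monotone_sort g).strictMono_of_injective
    (hg.comp (Tuple.sort g).injective)⟩

-- By symmetry under swapping `i'` with `k`, every `k ≠ i` is close to `i` in equally many orders.
-- Summing over `k` and exchanging the sums, each order contributes at most `2 * m` indices, those
-- placed within `m` steps of `i`.
open Classical in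
theorem card_filter_close_le {N m : ℕ} {i i' : Fin N} (hi : i ≠ i') :
    (N - 1) * (Finset.univ.filter fun σ : Equiv.Perm (Fin N) =>
        (σ.symm i).val < (σ.symm i').val + m ∧ (σ.symm i').val < (σ.symm i).val + m).card ≤
      N.factorial * (2 * m) := by
  set C : Fin N → Finset (Equiv.Perm (Fin N)) := fun i' => Finset.univ.filter fun σ =>
    (σ.symm i).val < (σ.symm i').val + m ∧ (σ.symm i').val < (σ.symm i).val + m with hC
  have hcard (k : Fin N) (hk : k ≠ i) : (C k).card = (C i').card := by
    refine Finset.card_equiv (Equiv.mulLeft (Equiv.swap i' k)) fun σ => ?_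
    have h1 : (Equiv.swap i' k).symm i = i := by
      rw [Equiv.symm_swap]
      exact Equiv.swap_apply_of_ne_of_ne hi hk.symm
    simp only [hC, Finset.mem_filter, Finset.mem_univ, true_and, Equiv.coe_mulLeft]
    have h2 (l : Fin N) : (Equiv.swap i' k * σ).symm l = σ.symm ((Equiv.swap i' k).symm l) := rfl
    rw [h2, h2, h1, Equiv.symm_swap, Equiv.swap_apply_left]
  have hsum : ∑ k ∈ Finset.univ.erase i, (C k).card = (N - 1) * (C i').card := by
    rw [Finset.sum_congr rfl fun k hk => hcard k (Finset.ne_of_mem_erase hk), Finset.sum_const,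
      Finset.card_erase_of_mem (Finset.mem_univ i), Finset.card_univ, Fintype.card_fin, smul_eq_mul]
  change (N - 1) * (C i').card ≤ _
  rw [← hsum]
  have hcount : ∑ k ∈ Finset.univ.erase i, (C k).card ≤
      ∑ σ : Equiv.Perm (Fin N), (Finset.univ.filter fun k : Fin N =>
        (σ.symm i).val < (σ.symm k).val + m ∧ (σ.symm k).val < (σ.symm i).val + m).card := by
    refine (Finset.sum_le_sum_of_subset (Finset.erase_subset i _)).trans (le_of_eq ?_)
    simp only [hC, Finset.card_filter]
    exact Finset.sum_comm
  refine hcount.trans ((Finset.sum_le_card_nsmul _ _ (2 * m) fun σ _ => ?_).trans (le_of_eq ?_))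
  · have hsub : (Finset.univ.filter fun k : Fin N =>
        (σ.symm i).val < (σ.symm k).val + m ∧ (σ.symm k).val < (σ.symm i).val + m).card ≤
        (Finset.Ico ((σ.symm i).val + 1 - m) ((σ.symm i).val + m)).card := by
      refine Finset.card_le_card_of_injOn (fun k => (σ.symm k).val) (fun k hk => ?_) ?_
      · have := (Finset.mem_filter.1 hk).2
        simp only [Finset.coe_Ico, Set.mem_Ico]
        omega
      · exact fun k _ l _ h => σ.symm.injective (Fin.ext h)
    refine hsub.trans ?_
    rw [Nat.card_Ico]
    omega
  · rw [Finset.card_univ, Fintype.card_perm, Fintype.card_fin, smul_eq_mul]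

/-- The observation orders in which two of the items `f i` are fewer than `m` steps apart. -/
def closeOrders {n N : ℕ} (f : Fin n → Fin N) (m : ℕ) : Set (Equiv.Perm (Fin N)) :=
  {σ | ∃ i j, i ≠ j ∧ (σ.symm (f i)).val < (σ.symm (f j)).val + m ∧
    (σ.symm (f j)).val < (σ.symm (f i)).val + m}

open Classical in
theorem card_closeOrders_le {n N : ℕ} {f : Fin n → Fin N} (hf : Function.Injective f) (m : ℕ) :
    (N - 1) * (Finset.univ.filter fun σ => σ ∈ closeOrders f m).card ≤
      N.factorial * (n * n * (2 * m)) := by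
  have hsub : (Finset.univ.filter fun σ => σ ∈ closeOrders f m) ⊆
      (Finset.univ : Finset (Fin n)).offDiag.biUnion fun q => Finset.univ.filter fun σ =>
        (σ.symm (f q.1)).val < (σ.symm (f q.2)).val + m ∧
          (σ.symm (f q.2)).val < (σ.symm (f q.1)).val + m := by
    intro σ hσ
    obtain ⟨i, j, hij, h⟩ := (Finset.mem_filter.1 hσ).2
    exact Finset.mem_biUnion.2 ⟨(i, j), Finset.mem_offDiag.2
      ⟨Finset.mem_univ i, Finset.mem_univ j, hij⟩, Finset.mem_filter.2 ⟨Finset.mem_univ σ, h⟩⟩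
  refine (Nat.mul_le_mul_left _ ((Finset.card_le_card hsub).trans Finset.card_biUnion_le)).trans ?_
  rw [Finset.mul_sum]
  refine (Finset.sum_le_card_nsmul _ _ (N.factorial * (2 * m)) fun q hq => ?_).trans ?_
  · exact card_filter_close_le (hf.ne (Finset.mem_offDiag.1 hq).2.2)
  · rw [smul_eq_mul, Finset.offDiag_card, Finset.card_univ, Fintype.card_fin]
    calc (n * n - n) * (N.factorial * (2 * m)) ≤ n * n * (N.factorial * (2 * m)) :=
          Nat.mul_le_mul_right _ (Nat.sub_le _ _)
      _ = _ := by ring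

end Orders

/-! ### From an algorithm for `D` to one for `Dinf` -/

section Reduction

variable {Ω : Type*} [MeasurableSpace Ω] {D : ℕ → ℝ≥0 → ℝ≥0} {Dinf : ℝ≥0 → ℝ≥0}
  {P : Measure Ω} [IsProbabilityMeasure P]

theorem sum_perm_inv_mul_const (n : ℕ) (b : ℝ≥0∞) :
    ∑ _σ : Equiv.Perm (Fin n), (n.factorial : ℝ≥0∞)⁻¹ * b = b := by
  rw [Finset.sum_const, Finset.card_univ, Fintype.card_perm, Fintype.card_fin, nsmul_eq_mul,
    ← mul_assoc, ENNReal.mul_inv_cancel (Nat.cast_ne_zero.2 n.factorial_ne_zero)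
    (ENNReal.natCast_ne_top _), one_mul]

-- The permutations `ρ.viaEmbedding f * σ` share the positions of the items and the arrangement of
-- the zeros, so one simulation serves all `ρ`. If `σ` puts two items too close, the trivial bound
-- by `I.opt` is used.
open Classical in
theorem IsDecay.exists_simulation_of_order (hD : IsDecay D)
    (hDinf : ∀ x, Tendsto (fun j => D j x) atTop (𝓝 (Dinf x))) (A : Algorithm Ω) (M : OrderModel)
    (I : Input) {m N : ℕ} (hm : 1 ≤ m) (f : Fin I.n ↪ Fin N) (σ : Equiv.Perm (Fin N)) :
    ∃ e c, ∑ ρ : Equiv.Perm (Fin I.n), (I.n.factorial : ℝ≥0∞)⁻¹ *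
        A.orderReward P M D (I.pad f) (ρ.viaEmbedding f * σ) ≤
      ∑ a, (I.n.factorial : ℝ≥0∞)⁻¹ *
          Simulation.orderReward ⟨I.pad f, e, f, c⟩ A P M (fun _ => Dinf) a +
        ∫⁻ x : Fin I.n → ℝ≥0, (decayLoss D Dinf m x : ℝ≥0∞) ∂I.law +
        if σ ∈ closeOrders f m then I.opt else 0 := by
  by_cases hσ : σ ∈ closeOrders f m
  · refine ⟨f, fun _ => none, ?_⟩
    rw [if_pos hσ]
    refine le_add_left ((Finset.sum_le_sum fun ρ _ => mul_le_mul_right ?_ _).trans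
      (sum_perm_inv_mul_const I.n I.opt).le)
    exact (hD.orderReward_le_opt A M (I.pad f) _).trans (I.opt_pad f.injective).le
  -- Sorting the positions of the items under `σ` gives the increasing map `e`; the item at `e j` in
  -- the order `ρ.viaEmbedding f * σ` is then `f ((ρ * a) j)`.
  · obtain ⟨a, ha⟩ := exists_perm_strictMono_comp (σ.symm.injective.comp f.injective)
    set e : Fin I.n → Fin N := fun j => σ.symm (f (a j)) with he
    have hgap (i j : Fin I.n) (hij : i < j) : (e i).val + m ≤ (e j).val := by
      by_contra hlt
      have hlt' : (e i).val < (e j).val := ha hij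
      exact hσ ⟨a i, a j, a.injective.ne hij.ne, by simp only [he] at *; omega,
        by simp only [he] at *; omega⟩
    refine ⟨e, fun k => M.label (σ k), ?_⟩
    rw [if_neg hσ, add_zero]
    have hle (ρ : Equiv.Perm (Fin I.n)) := hD.orderReward_pad_le (P := P) hDinf A M hm f.injective
      hgap (c := fun k => M.label (σ k)) (σ := ρ.viaEmbedding f * σ) (a := ρ * a)
      (fun j => by
        simp only [he, Equiv.Perm.mul_apply, Equiv.apply_symm_apply,
          Equiv.Perm.viaEmbedding_apply])
      (fun k hk => by
        rw [Equiv.Perm.mul_apply, Equiv.Perm.viaEmbedding_apply_of_notMem]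
        rintro ⟨i, hi⟩
        exact hk ⟨a.symm i, by simp [he, hi]⟩)
    refine (Finset.sum_le_sum fun ρ _ => mul_le_mul_right (hle ρ) _).trans ?_
    simp only [mul_add]
    rw [Finset.sum_add_distrib, sum_perm_inv_mul_const]
    exact add_le_add_left (Equiv.sum_comp (Equiv.mulRight a) fun a' =>
      (I.n.factorial : ℝ≥0∞)⁻¹ * Simulation.orderReward ⟨I.pad f, e, f, fun k => M.label (σ k)⟩
        A P M (fun _ => Dinf) a').le _

open Classical in
theorem inv_factorial_mul_card_closeOrders_le {n N m : ℕ} {f : Fin n → Fin N}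
    (hf : Function.Injective f) (hN : 2 ≤ N) {δ : ℝ≥0∞}
    (hδ : ((n * n * (2 * m) : ℕ) : ℝ≥0∞) ≤ δ * ((N - 1 : ℕ) : ℝ≥0∞)) :
    (N.factorial : ℝ≥0∞)⁻¹ * ((Finset.univ.filter fun σ => σ ∈ closeOrders f m).card : ℝ≥0∞) ≤
      δ := by
  rw [mul_comm, ← div_eq_mul_inv]
  refine ENNReal.div_le_of_le_mul ?_
  have h : (((N - 1 : ℕ) : ℝ≥0∞) *
      ((Finset.univ.filter fun σ => σ ∈ closeOrders f m).card : ℝ≥0∞)) ≤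
      N.factorial * (n * n * (2 * m) : ℕ) := by
    exact_mod_cast card_closeOrders_le hf m
  have h' : (((N - 1 : ℕ) : ℝ≥0∞) *
      ((Finset.univ.filter fun σ => σ ∈ closeOrders f m).card : ℝ≥0∞)) ≤
      ((N - 1 : ℕ) : ℝ≥0∞) * (δ * N.factorial) := by
    refine h.trans ((mul_le_mul_right hδ _).trans (le_of_eq ?_))
    ring
  exact (ENNReal.mul_le_mul_iff_right (Nat.cast_ne_zero.2 (by omega))
    (ENNReal.natCast_ne_top _)).1 h'

theorem IsDecay.exists_simulation_of_uniform (hD : IsDecay D)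
    (hDinf : ∀ x, Tendsto (fun j => D j x) atTop (𝓝 (Dinf x))) (A : Algorithm Ω) {M : OrderModel}
    (hM : ∀ n σ, M.orderLaw n σ = (n.factorial : ℝ≥0∞)⁻¹)
    (I : Input) {m N : ℕ} (hm : 1 ≤ m) (hN : 2 ≤ N) (f : Fin I.n ↪ Fin N) {δ : ℝ≥0∞}
    (hδ : ((I.n * I.n * (2 * m) : ℕ) : ℝ≥0∞) ≤ δ * ((N - 1 : ℕ) : ℝ≥0∞)) :
    ∃ s : Simulation I, s.J.opt = I.opt ∧ A.expReward P M D s.J ≤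
      ∑ a, M.orderLaw I.n a * s.orderReward A P M (fun _ => Dinf) a +
        ∫⁻ x : Fin I.n → ℝ≥0, (decayLoss D Dinf m x : ℝ≥0∞) ∂I.law + δ * I.opt := by
  classical
  choose e c hec using hD.exists_simulation_of_order (P := P) hDinf A M I hm f
  set V : Equiv.Perm (Fin N) → ℝ≥0∞ := fun σ => ∑ a, (I.n.factorial : ℝ≥0∞)⁻¹ *
    Simulation.orderReward ⟨I.pad f, e σ, f, c σ⟩ A P M (fun _ => Dinf) a with hV
  -- Derandomization: the seed space `Ω` is fixed, so the pattern of zeros cannot be drawn at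
  -- random; a best one is used instead.
  obtain ⟨σ₀, hσ₀⟩ := Finite.exists_max V
  set loss := ∫⁻ x : Fin I.n → ℝ≥0, (decayLoss D Dinf m x : ℝ≥0∞) ∂I.law
  refine ⟨⟨I.pad f, e σ₀, f, c σ₀⟩, I.opt_pad f.injective, ?_⟩
  rw [A.expReward_eq_sum]
  simp only [hM]
  change ∑ σ : Equiv.Perm (Fin N), (N.factorial : ℝ≥0∞)⁻¹ * A.orderReward P M D (I.pad f) σ ≤
    V σ₀ + loss + δ * I.opt
  set g := fun σ : Equiv.Perm (Fin N) => A.orderReward P M D (I.pad f) σ with hg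
  -- The uniform law is invariant under left multiplication, so averaging over `ρ` changes nothing.
  have hinv (ρ : Equiv.Perm (Fin I.n)) :
      ∑ σ, (N.factorial : ℝ≥0∞)⁻¹ * g (ρ.viaEmbedding f * σ) =
        ∑ σ, (N.factorial : ℝ≥0∞)⁻¹ * g σ :=
    Equiv.sum_comp (Equiv.mulLeft (ρ.viaEmbedding f)) fun σ => (N.factorial : ℝ≥0∞)⁻¹ * g σ
  calc ∑ σ, (N.factorial : ℝ≥0∞)⁻¹ * g σ
      = ∑ ρ : Equiv.Perm (Fin I.n), (I.n.factorial : ℝ≥0∞)⁻¹ *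
          ∑ σ, (N.factorial : ℝ≥0∞)⁻¹ * g (ρ.viaEmbedding f * σ) := by
        simp only [hinv]
        rw [sum_perm_inv_mul_const]
    _ = ∑ σ, (N.factorial : ℝ≥0∞)⁻¹ * ∑ ρ : Equiv.Perm (Fin I.n), (I.n.factorial : ℝ≥0∞)⁻¹ *
          g (ρ.viaEmbedding f * σ) := by
        simp only [Finset.mul_sum]
        rw [Finset.sum_comm]
        exact Finset.sum_congr rfl fun _ _ => Finset.sum_congr rfl fun _ _ => mul_left_comm _ _ _
    _ ≤ ∑ σ, (N.factorial : ℝ≥0∞)⁻¹ *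
          (V σ₀ + loss + if σ ∈ closeOrders f m then I.opt else 0) := by
        refine Finset.sum_le_sum fun σ _ => mul_le_mul_right ((hec σ).trans ?_) _
        exact add_le_add_left (add_le_add_left (hσ₀ σ) _) _
    _ = V σ₀ + loss + (N.factorial : ℝ≥0∞)⁻¹ *
          ((Finset.univ.filter fun σ => σ ∈ closeOrders f m).card : ℝ≥0∞) * I.opt := by
        simp only [mul_add (N.factorial : ℝ≥0∞)⁻¹ (V σ₀ + loss)]
        rw [Finset.sum_add_distrib, sum_perm_inv_mul_const, ← Finset.mul_sum, ← Finset.sum_filter,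
          Finset.sum_const, nsmul_eq_mul, mul_assoc]
    _ ≤ V σ₀ + loss + δ * I.opt :=
        add_le_add_right (mul_le_mul_left
          (inv_factorial_mul_card_closeOrders_le f.injective hN hδ) _) _

theorem IsDecay.exists_simulation_of_adversarial (hD : IsDecay D)
    (hDinf : ∀ x, Tendsto (fun j => D j x) atTop (𝓝 (Dinf x))) (A : Algorithm Ω)
    (I : Input) {m N : ℕ} (hm : 1 ≤ m) (f : Fin I.n ↪ Fin N)
    (hgap : ∀ i j, i < j → (f i).val + m ≤ (f j).val) :
    ∃ s : Simulation I, s.J.opt = I.opt ∧ A.expReward P .adversarial D s.J ≤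
      ∑ a, OrderModel.adversarial.orderLaw I.n a *
          s.orderReward A P .adversarial (fun _ => Dinf) a +
        ∫⁻ x : Fin I.n → ℝ≥0, (decayLoss D Dinf m x : ℝ≥0∞) ∂I.law := by
  have hsum (n : ℕ) (g : Equiv.Perm (Fin n) → ℝ≥0∞) :
      ∑ σ, OrderModel.adversarial.orderLaw n σ * g σ = g 1 := by
    rw [Finset.sum_eq_single 1]
    · simp [OrderModel.orderLaw]
    · intro σ _ hσ
      simp [OrderModel.orderLaw, hσ]
    · exact fun h => (h (Finset.mem_univ 1)).elim
  refine ⟨⟨I.pad f, f, f, fun _ => none⟩, I.opt_pad f.injective, ?_⟩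
  rw [A.expReward_eq_sum, hsum, hsum]
  exact hD.orderReward_pad_le hDinf A .adversarial hm f.injective hgap (fun _ => rfl)
    fun _ _ => rfl

theorem IsDecay.exists_simulation (hD : IsDecay D)
    (hDinf : ∀ x, Tendsto (fun j => D j x) atTop (𝓝 (Dinf x))) (A : Algorithm Ω) (M : OrderModel)
    (I : Input) (hI : I.opt ≠ 0) {δ : ℝ≥0} (hδ : 0 < δ) :
    ∃ s : Simulation I, s.J.opt = I.opt ∧ A.expReward P M D s.J ≤
      ∑ a, M.orderLaw I.n a * s.orderReward A P M (fun _ => Dinf) a + δ * I.opt := by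
  have hδ2 : (0 : ℝ≥0) < δ / 2 := half_pos hδ
  have hpos : (0 : ℝ≥0∞) < (δ / 2 : ℝ≥0) * I.opt :=
    ENNReal.mul_pos (ENNReal.coe_ne_zero.2 hδ2.ne') hI
  -- The error budget `δ * I.opt` is split evenly between the decay loss and the close orders.
  obtain ⟨m, hloss, hm⟩ := (((hD.tendsto_lintegral_decayLoss hDinf I).eventually
    (gt_mem_nhds hpos)).and (eventually_ge_atTop 1)).exists
  obtain ⟨K, hK⟩ := exists_nat_gt (((I.n * I.n * (2 * m) : ℕ) : ℝ≥0) / (δ / 2))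
  have hfN (j : Fin I.n) : j.val * m < I.n * m + K + 2 := by
    have := Nat.mul_le_mul_right m j.2.le
    omega
  have hgap (i j : Fin I.n) (hij : i < j) : i.val * m + m ≤ j.val * m := by
    rw [← Nat.succ_mul]
    exact Nat.mul_le_mul_right m hij
  -- The multiples of `m` give the gaps for the adversarial order; in the random orders only
  -- injectivity matters, and the extra `K + 2` items make close orders rare.
  let f : Fin I.n ↪ Fin (I.n * m + K + 2) :=
    ⟨fun j => ⟨j.val * m, hfN j⟩, fun i j hij =>
      Fin.ext (Nat.eq_of_mul_eq_mul_right hm (Fin.mk.inj_iff.1 hij))⟩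
  have hcount : ((I.n * I.n * (2 * m) : ℕ) : ℝ≥0∞) ≤
      ((δ / 2 : ℝ≥0) : ℝ≥0∞) * ((I.n * m + K + 2 - 1 : ℕ) : ℝ≥0∞) := by
    have h1 : ((I.n * I.n * (2 * m) : ℕ) : ℝ≥0) ≤ δ / 2 * (I.n * m + K + 2 - 1 : ℕ) := by
      refine ((div_lt_iff₀' hδ2).1 hK).le.trans (mul_le_mul_right ?_ _)
      exact Nat.cast_le.2 (by omega)
    exact_mod_cast h1
  have hhalf : ((δ / 2 : ℝ≥0) : ℝ≥0∞) * I.opt + (δ / 2 : ℝ≥0) * I.opt = δ * I.opt := by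
    rw [← add_mul, ← ENNReal.coe_add, add_halves]
  have huniform (hM : ∀ n σ, M.orderLaw n σ = (n.factorial : ℝ≥0∞)⁻¹) :
      ∃ s : Simulation I, s.J.opt = I.opt ∧ A.expReward P M D s.J ≤
        ∑ a, M.orderLaw I.n a * s.orderReward A P M (fun _ => Dinf) a + δ * I.opt := by
    obtain ⟨s, hs, hle⟩ := hD.exists_simulation_of_uniform (P := P) hDinf A hM I hm (by omega) f
      hcount
    refine ⟨s, hs, hle.trans ?_⟩
    rw [add_assoc, ← hhalf]
    exact add_le_add_right (add_le_add_left hloss.le _) _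
  cases M with
  | adversarial =>
    obtain ⟨s, hs, hle⟩ := hD.exists_simulation_of_adversarial (P := P) hDinf A I hm f hgap
    refine ⟨s, hs, hle.trans (add_le_add_right ?_ _)⟩
    rw [← hhalf]
    exact hloss.le.trans le_self_add
  | randomOrder =>
    exact huniform fun n σ => by
      simp [OrderModel.orderLaw, PMF.uniformOfFintype_apply, Fintype.card_perm]
  | randomOrderLabelled =>
    exact huniform fun n σ => by
      simp [OrderModel.orderLaw, PMF.uniformOfFintype_apply, Fintype.card_perm]

theorem IsDecay.exists_competitiveRatio_le (hD : IsDecay D)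
    (hDinf : ∀ x, Tendsto (fun j => D j x) atTop (𝓝 (Dinf x))) (A : Algorithm Ω) (M : OrderModel)
    {δ : ℝ≥0} (hδ : 0 < δ) :
    ∃ B : Algorithm Ω,
      A.competitiveRatio P M D ≤ B.competitiveRatio P M (fun _ => Dinf) + δ := by
  have h (I : Input) : ∃ s : Simulation I, I.opt ≠ 0 → s.J.opt = I.opt ∧
      A.expReward P M D s.J ≤
        ∑ a, M.orderLaw I.n a * s.orderReward A P M (fun _ => Dinf) a + δ * I.opt := by
    by_cases hI : I.opt = 0
    -- An arbitrary simulation: such inputs do not enter the competitive ratio.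
    · exact ⟨⟨I, id, id, fun _ => none⟩, fun h => (h hI).elim⟩
    · obtain ⟨s, hs⟩ := hD.exists_simulation (P := P) hDinf A M I hI hδ
      exact ⟨s, fun _ => hs⟩
  choose S hS using h
  refine ⟨A.simulate S, ?_⟩
  rw [← tsub_le_iff_right]
  refine le_iInf₂ fun I hI => ?_
  obtain ⟨hopt, hle⟩ := hS I hI
  rw [tsub_le_iff_right]
  calc A.competitiveRatio P M D ≤ A.expReward P M D (S I).J / (S I).J.opt :=
        iInf₂_le (S I).J (hopt ▸ hI)
    _ ≤ ((A.simulate S).expReward P M (fun _ => Dinf) I + δ * I.opt) / I.opt := by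
        rw [hopt]
        exact ENNReal.div_le_div_right hle _
    _ = (A.simulate S).expReward P M (fun _ => Dinf) I / I.opt + δ := by
        rw [ENNReal.add_div, ENNReal.mul_div_cancel_right hI I.opt_ne_top]

end Reduction

theorem IsDecay.competitiveRatio_limit_le {Ω : Type*} [MeasurableSpace Ω] {P : Measure Ω}
    {D : ℕ → ℝ≥0 → ℝ≥0} {Dinf : ℝ≥0 → ℝ≥0} (hD : IsDecay D)
    (hDinf : ∀ x, Tendsto (fun j => D j x) atTop (𝓝 (Dinf x))) (A : Algorithm Ω)
    (M : OrderModel) :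
    A.competitiveRatio P M (fun _ => Dinf) ≤ A.competitiveRatio P M D :=
  iInf₂_mono fun _ _ => ENNReal.div_le_div_right (Finset.sum_le_sum fun _ _ =>
    mul_le_mul_right (lintegral_mono fun _ =>
      ENNReal.coe_le_coe.2 (hD.reward_limit_le hDinf _ _)) _) _

end Prophet

theorem corollary1 {Ω : Type*} [MeasurableSpace Ω] (P : Measure Ω) [IsProbabilityMeasure P]
    (M : Prophet.OrderModel) (D : ℕ → ℝ≥0 → ℝ≥0) (hD : Prophet.IsDecay D)
    (Dinf : ℝ≥0 → ℝ≥0) (hDinf : ∀ x, Tendsto (fun j => D j x) atTop (𝓝 (Dinf x)))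
    (A : Prophet.Algorithm Ω) (hA : A.IsOptimal P M (fun _ => Dinf)) :
    A.IsOptimal P M D ∧
      A.competitiveRatio P M D = A.competitiveRatio P M (fun _ => Dinf) := by
  have hle (B : Prophet.Algorithm Ω) :
      B.competitiveRatio P M D ≤ A.competitiveRatio P M (fun _ => Dinf) := by
    refine ENNReal.le_of_forall_pos_le_add fun δ hδ _ => ?_
    obtain ⟨C, hC⟩ := hD.exists_competitiveRatio_le (P := P) hDinf B M hδ
    exact hC.trans (add_le_add_left (hA C) _)
  have hge := hD.competitiveRatio_limit_le (P := P) hDinf A M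
  exact ⟨fun B => (hle B).trans hge, (hle A).antisymm hge⟩
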